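/- Consider a two-tier femtocell network with one macrocell base station (MBS) and $K$ femtocell users (FUs) $k\in\mathcal K=\{1,\dots,K\}$; index $0$ stands for the macrocell user and the MBS. Let $h_{i,j}\ge 0$ be the channel power gain from transmitter $i$ to receiver $j$, $N_k>0$ the noise variance at receiver $k$, $W>0$ the bandwidth, $p_0\ge 0$ the fixed power of the macrocell user, $p_a>0$ the circuit power and $p_k^{\max}\ge 0$ the peak power of FU $k$. FU $k$ chooses a power $p_k\in[0,p_k^{\max}]$, and the MBS chooses a price vector $\boldsymbol\lambda=(\lambda_1,\dots,\lambda_K)$ in a set $\boldsymbol\Lambda\subseteq[0,\infty)^K$. The payoffs are $$u_0(\boldsymbol\lambda,\mathbf p)=\sum_{k\in\mathcal K}\lambda_k h_{k,0}p_k,\qquad u_k(\boldsymbol\lambda,\mathbf p)=\frac{W\log(1+\gamma_k)}{p_k+p_a}-\lambda_k h_{k,0}p_k,\qquad \gamma_k=\frac{h_{k,k}p_k}{N_k+h_{0,k}p_0+\sum_{j\in\mathcal K\setminus\{k\}}h_{j,k}p_j}.$$ A pair $(\boldsymbol\lambda^*,\mathbf p^*)$ with $\boldsymbol\lambda^*\in\boldsymbol\Lambda$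 and $\mathbf p^*\in\prod_k[0,p_k^{\max}]$ is a (pure-strategy) Stackelberg equilibrium if $u_0(\boldsymbol\lambda^*,\mathbf p^*)\ge u_0(\boldsymbol\lambda,\mathbf p^*)$ for all $\boldsymbol\lambda\in\boldsymbol\Lambda$, and $u_k(\boldsymbol\lambda^*,p_k^*,\mathbf p_{-k}^*)\ge u_k(\boldsymbol\lambda^*,p_k,\mathbf p_{-k}^*)$ for all $k\in\mathcal K$ and all $p_k\in[0,p_k^{\max}]$. Theorem. A pure-strategy Stackelberg equilibrium whose prices $\lambda_k^*$ are all finite exists both when the prices are only required to be nonnegative, i.e. $\boldsymbol\Lambda=[0,\infty)^K$, and when $\boldsymbol\Lambda$ is any nonempty compact convex subset of $[0,\infty)^K$. -/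

import Mathlib

/-- The data of a two-tier femtocell network with one macrocell and `K` femtocells.
Transmitter-receiver pairs are indexed by `Fin (K + 1)`: index `0` is the macrocell pair
(macrocell user and MBS), and index `k.succ` is the `k`-th pair (femtocell user and femtocell
access point), `k : Fin K`. -/
structure FemtocellNetwork (K : ℕ) where
  /-- `h i j` is the power gain from the transmitter of pair `i` to the receiver of pair `j`. -/
  h : Fin (K + 1) → Fin (K + 1) → ℝ
  /-- Noise variance of each pair. -/
  N : Fin (K + 1) → ℝ
  /-- Shared bandwidth. -/
  W : ℝ
  /-- Fixed transmit power of the macrocell user. -/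
  p₀ : ℝ
  /-- Additional circuit power of a femtocell user. -/
  pa : ℝ
  /-- Peak transmit power of each femtocell user. -/
  pmax : Fin K → ℝ

namespace FemtocellNetwork

/-- The sign conventions on the physical parameters: power gains, the power of the macrocell user
and the peak powers are nonnegative; bandwidth, circuit power and noise are positive. -/
structure Physical {K : ℕ} (F : FemtocellNetwork K) : Prop where
  h_nonneg : ∀ i j, 0 ≤ F.h i j
  N_pos : ∀ i, 0 < F.N i
  W_pos : 0 < F.W
  p₀_nonneg : 0 ≤ F.p₀
  pa_pos : 0 < F.pa
  pmax_nonneg : ∀ k, 0 ≤ F.pmax k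

variable {K : ℕ} (F : FemtocellNetwork K)

/-- Signal-to-interference-plus-noise ratio at the `k`-th femtocell access point. -/
noncomputable def sinr (p : Fin K → ℝ) (k : Fin K) : ℝ :=
  F.h k.succ k.succ * p k /
    (F.N k.succ + F.h 0 k.succ * F.p₀ + ∑ j ∈ Finset.univ.erase k, F.h j.succ k.succ * p j)

/-- Energy efficiency of femtocell user `k`. -/
noncomputable def energyEfficiency (p : Fin K → ℝ) (k : Fin K) : ℝ :=
  F.W * Real.log (1 + F.sinr p k) / (p k + F.pa)

/-- Net payoff of femtocell user `k` at prices `l` and powers `p`. -/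
noncomputable def userPayoff (l p : Fin K → ℝ) (k : Fin K) : ℝ :=
  F.energyEfficiency p k - l k * F.h k.succ 0 * p k

/-- Revenue of the MBS at prices `l` and powers `p`. -/
noncomputable def revenue (l p : Fin K → ℝ) : ℝ :=
  ∑ k, l k * F.h k.succ 0 * p k

/-- The joint (pure) strategy space of the femtocell users, `∏ k, [0, pmax k]`. -/
def powerSpace : Set (Fin K → ℝ) :=
  {p | ∀ k, p k ∈ Set.Icc 0 (F.pmax k)}

/-- `p` is a pure-strategy Nash equilibrium of the follower game at prices `l`. -/
def IsFollowerNash (l p : Fin K → ℝ) : Prop :=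
  p ∈ F.powerSpace ∧
    ∀ k, ∀ q ∈ Set.Icc 0 (F.pmax k), F.userPayoff l (Function.update p k q) k ≤ F.userPayoff l p k

/-- `(l, p)` is a pure-strategy Stackelberg equilibrium when the price vectors available to the
MBS are those of `Λ`: given `p`, the price vector `l` maximizes the revenue over `Λ`, and given
`l`, no femtocell user gains by a unilateral deviation. -/
def IsStackelbergEquilibrium (Λ : Set (Fin K → ℝ)) (l p : Fin K → ℝ) : Prop :=
  (l ∈ Λ ∧ ∀ l' ∈ Λ, F.revenue l' p ≤ F.revenue l p) ∧ F.IsFollowerNash l p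

end FemtocellNetwork

/-!
The MBS and the users form a game on the compact convex set of pairs (prices in `Λ`, powers).
By the Hartman–Stampacchia theorem `exists_variational_inequality` the pseudogradient of this game,
which collects the derivative of each player's payoff in that player's own variables, satisfies a
variational inequality at some point: every player satisfies the first-order condition for
optimality there. For the MBS this is optimality, since revenue is linear in the prices. For a user
it is optimality as well (`netUtility_le_of_stationary`): energy efficiency is concave up to its
peak and decreasing afterwards, so that energy efficiency minus a linear cost is pseudoconcave.

When all nonnegative prices are allowed, the previous case is applied to a single price vector that
is high enough to silence every user whom the MBS can hear. The revenue is then identically zero.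

The Hartman–Stampacchia theorem follows from Brouwer's fixed point theorem, proved here by the
volume argument of Milnor and Rogers. If `r` were a `C¹` retraction of the unit ball onto the
sphere, the integral over the ball of the Jacobian determinant of `(1 - t) id + t r` would be a
polynomial in `t`, equal to the volume of the ball for small `t > 0` and to zero for `t = 1`.
-/

open Set Metric MeasureTheory Filter Topology

/-! ### Brouwer's fixed point theorem and variational inequalities -/

section Brouwer

/-- Lagrange interpolation: the value at `1` of a polynomial of degree at most `n` is a fixed
linear combination of its values at `n + 1` nodes in `(0, δ)`. -/
theorem exists_weights_eval_one (n : ℕ) {δ : ℝ} (hδ : 0 < δ) :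
    ∃ (t w : ℕ → ℝ), (∀ i, 0 < t i ∧ t i < δ) ∧
      ∀ P : Polynomial ℝ, P.natDegree ≤ n →
        P.eval 1 = ∑ i ∈ Finset.range (n + 1), w i * P.eval (t i) := by
  have hinj : Set.InjOn (fun i : ℕ => δ / (i + 2)) (Finset.range (n + 1) : Finset ℕ) := by
    intro i _ j _ hij
    have hi : (0 : ℝ) < i + 2 := by positivity
    have hj : (0 : ℝ) < j + 2 := by positivity
    have := (div_eq_div_iff hi.ne' hj.ne').1 hij
    have := mul_left_cancel₀ hδ.ne' this
    exact_mod_cast (by linarith : (i : ℝ) = j)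
  refine ⟨fun i => δ / (i + 2),
    fun i => (Lagrange.basis (Finset.range (n + 1)) (fun i : ℕ => δ / (i + 2)) i).eval 1,
    fun i => ⟨by positivity, ?_⟩, fun P hP => ?_⟩
  · have hi : (0 : ℝ) ≤ i := by positivity
    rw [div_lt_iff₀ (by positivity)]
    nlinarith
  · have hdeg : P.degree < (Finset.range (n + 1)).card := by
      rw [Finset.card_range]
      exact (Polynomial.degree_le_of_natDegree_le hP).trans_lt (by exact_mod_cast Nat.lt_succ_self n)
    conv_lhs => rw [Lagrange.eq_interpolate hinj hdeg]
    rw [Lagrange.interpolate_apply, Polynomial.eval_finsetSum]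
    refine Finset.sum_congr rfl fun i _ => ?_
    rw [Polynomial.eval_mul, Polynomial.eval_C, mul_comm]

variable {E : Type*} [NormedAddCommGroup E] [InnerProductSpace ℝ E] [FiniteDimensional ℝ E]

/-- `det (1 + t A)` is a polynomial in `t` of degree at most the dimension. -/
theorem exists_polynomial_eval_eq_det (A : E →L[ℝ] E) :
    ∃ P : Polynomial ℝ, P.natDegree ≤ Module.finrank ℝ E ∧
      ∀ t : ℝ, P.eval t = (ContinuousLinearMap.id ℝ E + t • A).det := by
  let b := Module.finBasis ℝ E
  let M := LinearMap.toMatrix b b (A : E →ₗ[ℝ] E)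
  refine ⟨_, (Polynomial.natDegree_det_X_add_C_le M 1).trans (by simp), fun t => ?_⟩
  have h : (ContinuousLinearMap.id ℝ E + t • A).det =
      (LinearMap.toMatrix b b (LinearMap.id + t • (A : E →ₗ[ℝ] E))).det := by
    rw [LinearMap.det_toMatrix]; rfl
  rw [h, map_add, map_smul, LinearMap.toMatrix_id, ← Polynomial.coe_evalRingHom, RingHom.map_det]
  congr 1
  ext i j
  rcases eq_or_ne i j with rfl | hij
  · simp [M]; ring
  · simp [M, hij]; ring

/-- For small `t > 0` the map `x ↦ (1 - t) x + t r(x)` is a bijection of the open unit ball with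
positive Jacobian determinant, whose integral is therefore the volume of the ball. -/
theorem integral_det_eq_volume [MeasurableSpace E] [BorelSpace E] {r : E → E}
    (hr : ∀ x ∈ closedBall (0 : E) 1, ContDiffAt ℝ 1 r x)
    (hnorm : ∀ x ∈ closedBall (0 : E) 1, ‖r x‖ ≤ 1) (hfix : ∀ x, ‖x‖ = 1 → r x = x) :
    ∃ δ > 0, ∀ t : ℝ, 0 < t → t < δ →
      ∫ x in ball (0 : E) 1,
        (ContinuousLinearMap.id ℝ E + t • (fderiv ℝ r x - ContinuousLinearMap.id ℝ E)).det =
      volume.real (ball (0 : E) 1) := by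
  obtain ⟨ε, hε, hdet⟩ : ∃ ε > 0, ∀ B : E →L[ℝ] E,
      dist B (ContinuousLinearMap.id ℝ E) < ε → 0 < B.det := by
    have h1 : (0 : ℝ) < (ContinuousLinearMap.id ℝ E).det := by
      simp [ContinuousLinearMap.det]
    exact Metric.eventually_nhds_iff.1
      ((ContinuousLinearMap.continuous_det (𝕜 := ℝ) (E := E)).continuousAt.eventually
        (lt_mem_nhds h1))
  set A : E → (E →L[ℝ] E) := fun x => fderiv ℝ r x - ContinuousLinearMap.id ℝ E with hA
  have hAc : ContinuousOn A (closedBall 0 1) := by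
    refine ContinuousOn.sub (fun x hx => ?_) continuousOn_const
    exact ((hr x hx).fderiv_right (m := 0) (by norm_num)).continuousAt.continuousWithinAt
  obtain ⟨C, hC⟩ := (isCompact_closedBall (0 : E) 1).exists_bound_of_continuousOn hAc
  set C' := max C 0 + 1
  have hC'0 : 0 < C' := by positivity
  have hC' : ∀ x ∈ closedBall (0 : E) 1, ‖A x‖ < C' := fun x hx =>
    (hC x hx).trans_lt ((le_max_left C 0).trans_lt (lt_add_one _))
  have hrd : ∀ x ∈ closedBall (0 : E) 1, HasStrictFDerivAt r (fderiv ℝ r x) x := fun x hx =>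
    (hr x hx).hasStrictFDerivAt (by norm_num)
  refine ⟨min 1 (min (ε / C') (1 / C')), by positivity, fun t ht0 ht => ?_⟩
  obtain ⟨ht1, ht2, ht3⟩ : t < 1 ∧ t < ε / C' ∧ t < 1 / C' := by simpa using ht
  rw [lt_div_iff₀ hC'0] at ht2 ht3
  set g : E → E := fun x => x + t • (r x - x) with hg
  have hgd : ∀ x ∈ closedBall (0 : E) 1,
      HasStrictFDerivAt g (ContinuousLinearMap.id ℝ E + t • A x) x := fun x hx =>
    (hasStrictFDerivAt_id x).add (((hrd x hx).sub (hasStrictFDerivAt_id x)).const_smul t)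
  have hpos : ∀ x ∈ closedBall (0 : E) 1, 0 < (ContinuousLinearMap.id ℝ E + t • A x).det := by
    intro x hx
    apply hdet
    rw [dist_eq_norm, add_sub_cancel_left, norm_smul, Real.norm_of_nonneg ht0.le]
    exact (mul_lt_mul_of_pos_left (hC' x hx) ht0).trans ht2
  -- `r - id` is Lipschitz with constant `C'`, and `t * C' < 1`.
  have hinj : InjOn g (closedBall 0 1) := by
    intro x hx y hy hxy
    have hlip : ‖(r y - y) - (r x - x)‖ ≤ C' * ‖y - x‖ :=
      (convex_closedBall (0 : E) 1).norm_image_sub_le_of_norm_hasFDerivWithin_le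
        (f := fun x => r x - x) (f' := A)
        (fun z hz => ((hrd z hz).hasFDerivAt.sub (hasFDerivAt_id z)).hasFDerivWithinAt)
        (fun z hz => (hC' z hz).le) hx hy
    have h1 : y - x = -(t • ((r y - y) - (r x - x))) := by
      have : x + t • (r x - x) = y + t • (r y - y) := hxy
      rw [smul_sub, ← add_right_inj (x + t • (r x - x))]
      nth_rw 2 [this]
      module
    have h2 : ‖y - x‖ ≤ t * (C' * ‖y - x‖) := by
      conv_lhs => rw [h1, norm_neg, norm_smul, Real.norm_of_nonneg ht0.le]
      gcongr
    have h3 : ‖y - x‖ = 0 := by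
      have := norm_nonneg (y - x)
      nlinarith
    exact (sub_eq_zero.1 (norm_eq_zero.1 h3)).symm
  have hball : ∀ x ∈ ball (0 : E) 1, g x ∈ ball (0 : E) 1 := by
    intro x hx
    have hx' := hnorm x (ball_subset_closedBall hx)
    rw [mem_ball_zero_iff] at hx ⊢
    have h1 : g x = (1 - t) • x + t • r x := by simp only [hg]; module
    rw [h1]
    refine (norm_add_le _ _).trans_lt ?_
    rw [norm_smul, norm_smul, Real.norm_of_nonneg ht0.le, Real.norm_of_nonneg (by linarith)]
    nlinarith
  -- The image is open by the inverse function theorem and relatively closed in the ball because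
  -- `g` fixes the sphere; the ball is connected.
  have himg : g '' ball 0 1 = ball 0 1 := by
    have hopen : IsOpen (g '' ball 0 1) := by
      rw [isOpen_iff_mem_nhds]
      rintro _ ⟨x, hx, rfl⟩
      have hx' := ball_subset_closedBall hx
      have hd : HasStrictFDerivAt g
          (((ContinuousLinearMap.id ℝ E + t • A x).toContinuousLinearEquivOfDetNeZero
            (hpos x hx').ne' : E ≃L[ℝ] E) : E →L[ℝ] E) x := by
        simpa using hgd x hx'
      rw [← hd.map_nhds_eq_of_equiv]
      exact image_mem_map (isOpen_ball.mem_nhds hx)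
    have hclosed : IsClosed (g '' closedBall 0 1) :=
      ((isCompact_closedBall (0 : E) 1).image_of_continuousOn
        fun x hx => (hgd x hx).continuousAt.continuousWithinAt).isClosed
    refine Subset.antisymm (image_subset_iff.2 hball) ?_
    refine (convex_ball (0 : E) 1).isPreconnected.subset_of_closure_inter_subset hopen
      ⟨g 0, hball 0 (by simp), mem_image_of_mem g (by simp)⟩ ?_
    rintro y ⟨hy, hyb⟩
    obtain ⟨x, hx, rfl⟩ := closure_minimal (image_mono ball_subset_closedBall) hclosed hy
    refine mem_image_of_mem g ?_
    rw [mem_closedBall_zero_iff] at hx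
    rw [mem_ball_zero_iff] at hyb ⊢
    refine lt_of_le_of_ne hx fun h => ?_
    simp [hg, hfix x h, h] at hyb
  have key := integral_image_eq_integral_abs_det_fderiv_smul volume measurableSet_ball
    (fun x hx => (hgd x (ball_subset_closedBall hx)).hasFDerivAt.hasFDerivWithinAt)
    (hinj.mono ball_subset_closedBall) (fun _ => (1 : ℝ))
  rw [himg] at key
  simp only [smul_eq_mul, mul_one, setIntegral_const] at key
  rw [key]
  exact setIntegral_congr_fun measurableSet_ball fun x hx =>
    (abs_of_pos (hpos x (ball_subset_closedBall hx))).symm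

/-- No `C¹` retraction of the ball onto the sphere: its Jacobian determinant vanishes identically,
but interpolation from small `t` shows that the determinant has the volume of the ball as its
integral. -/
theorem not_exists_contDiff_retraction {r : E → E}
    (hr : ∀ x ∈ closedBall (0 : E) 1, ContDiffAt ℝ 1 r x)
    (hnorm : ∀ x ∈ closedBall (0 : E) 1, ‖r x‖ = 1) (hfix : ∀ x, ‖x‖ = 1 → r x = x) : False := by
  borelize E
  obtain ⟨δ, hδ, hvol⟩ := integral_det_eq_volume hr (fun x hx => (hnorm x hx).le) hfix
  obtain ⟨t, w, ht, hw⟩ := exists_weights_eval_one (Module.finrank ℝ E) hδ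
  have hw1 : ∑ i ∈ Finset.range (Module.finrank ℝ E + 1), w i = 1 := by
    simpa using (hw 1 (by simp)).symm
  have hAdet : ∀ A : E →L[ℝ] E, (ContinuousLinearMap.id ℝ E + A).det =
      ∑ i ∈ Finset.range (Module.finrank ℝ E + 1),
        w i * (ContinuousLinearMap.id ℝ E + t i • A).det := by
    intro A
    obtain ⟨P, hP, hPe⟩ := exists_polynomial_eval_eq_det A
    simpa [hPe] using hw P hP
  have hzero : ∀ x ∈ ball (0 : E) 1, (fderiv ℝ r x).det = 0 := by
    intro x hx
    have hx' := ball_subset_closedBall hx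
    have hd : HasFDerivAt r (fderiv ℝ r x) x :=
      ((hr x hx').differentiableAt (by norm_num)).hasFDerivAt
    have hconst : (fun y => ‖r y‖ ^ 2) =ᶠ[𝓝 x] fun _ => (1 : ℝ) := by
      filter_upwards [isOpen_ball.mem_nhds hx] with y hy
      rw [hnorm y (ball_subset_closedBall hy), one_pow]
    have horth : ∀ v, inner ℝ (r x) (fderiv ℝ r x v) = 0 := by
      intro v
      have := (hd.norm_sq.congr_of_eventuallyEq hconst.symm).unique (hasFDerivAt_const (1 : ℝ) x)
      simpa using congrArg (fun L : E →L[ℝ] ℝ => L v) this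
    -- If the determinant were nonzero, `r x` would be in the range, hence orthogonal to itself.
    by_contra hne
    obtain ⟨v, hv⟩ := ((fderiv ℝ r x).toContinuousLinearEquivOfDetNeZero hne).surjective (r x)
    have hv' : fderiv ℝ r x v = r x := by simpa using hv
    have := horth v
    rw [hv', real_inner_self_eq_norm_sq, hnorm x hx'] at this
    norm_num at this
  have hcont : ContinuousOn (fderiv ℝ r) (closedBall 0 1) := fun x hx =>
    ((hr x hx).fderiv_right (m := 0) (by norm_num)).continuousAt.continuousWithinAt
  have hint : ∀ s : ℝ, IntegrableOn (fun x => (ContinuousLinearMap.id ℝ E +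
      s • (fderiv ℝ r x - ContinuousLinearMap.id ℝ E)).det) (ball (0 : E) 1) := by
    intro s
    refine IntegrableOn.mono_set ?_ ball_subset_closedBall
    refine ContinuousOn.integrableOn_compact (isCompact_closedBall _ _) ?_
    exact ContinuousLinearMap.continuous_det.comp_continuousOn
      (continuousOn_const.add ((hcont.sub continuousOn_const).const_smul s))
  have h0 : ∫ x in ball (0 : E) 1, (fderiv ℝ r x).det = 0 := by
    rw [setIntegral_congr_fun measurableSet_ball hzero]; simp
  have h1 : ∫ x in ball (0 : E) 1, (fderiv ℝ r x).det = volume.real (ball (0 : E) 1) := by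
    calc ∫ x in ball (0 : E) 1, (fderiv ℝ r x).det
        = ∫ x in ball (0 : E) 1, ∑ i ∈ Finset.range (Module.finrank ℝ E + 1),
            w i * (ContinuousLinearMap.id ℝ E +
              t i • (fderiv ℝ r x - ContinuousLinearMap.id ℝ E)).det := by
          congr 1
          ext x
          rw [← hAdet, add_sub_cancel]
      _ = ∑ i ∈ Finset.range (Module.finrank ℝ E + 1),
            w i * volume.real (ball (0 : E) 1) := by
          rw [integral_finsetSum _ fun i _ => (hint (t i)).const_mul (w i)]
          refine Finset.sum_congr rfl fun i _ => ?_
          rw [integral_const_mul, hvol (t i) (ht i).1 (ht i).2]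
      _ = _ := by rw [← Finset.sum_mul, hw1, one_mul]
  have hvpos : 0 < volume.real (ball (0 : E) 1) :=
    ENNReal.toReal_pos (measure_ball_pos volume 0 one_pos).ne' measure_ball_lt_top.ne
  linarith

/-- Brouwer's theorem for a `C¹` map that sends the closed unit ball into its interior. -/
theorem exists_fixedPoint_of_contDiff {f : E → E} (hf : ContDiff ℝ 1 f)
    (hbd : ∀ x ∈ closedBall (0 : E) 1, ‖f x‖ < 1) : ∃ x ∈ closedBall (0 : E) 1, f x = x := by
  by_contra! hne
  -- `x + s x • u x` is the point of the sphere on the ray from `f x` through `x`: `s x` is the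
  -- larger root of `‖x + s • u x‖ ^ 2 = 1`, and `D x` is a quarter of the discriminant.
  set u : E → E := fun x => x - f x with hu
  set D : E → ℝ := fun x => inner ℝ x (u x) ^ 2 + ‖u x‖ ^ 2 * (1 - ‖x‖ ^ 2) with hD
  set s : E → ℝ := fun x => (-inner ℝ x (u x) + √(D x)) / ‖u x‖ ^ 2 with hs
  have hu0 : ∀ x ∈ closedBall (0 : E) 1, 0 < ‖u x‖ ^ 2 := fun x hx =>
    pow_pos (norm_pos_iff.2 (sub_ne_zero.2 (hne x hx).symm)) 2
  have hinner : ∀ x, ‖x‖ = 1 → 0 < inner ℝ x (u x) := by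
    intro x hx
    have h1 := real_inner_le_norm x (f x)
    have h2 := hbd x (by simp [hx])
    rw [hx, one_mul] at h1
    simp only [hu, inner_sub_right, real_inner_self_eq_norm_sq, hx]
    linarith
  have hDpos : ∀ x ∈ closedBall (0 : E) 1, 0 < D x := by
    intro x hx
    rcases (mem_closedBall_zero_iff.1 hx).eq_or_lt with h | h
    · have := hinner x h
      simp only [hD, h]
      nlinarith
    · have h1 : 0 < 1 - ‖x‖ ^ 2 := by nlinarith [norm_nonneg x]
      have := mul_pos (hu0 x hx) h1
      simp only [hD]
      nlinarith [sq_nonneg (inner ℝ x (u x))]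
  have huc : ContDiff ℝ 1 u := contDiff_id.sub hf
  have hic : ContDiff ℝ 1 fun x => inner ℝ x (u x) := contDiff_id.inner ℝ huc
  have hDc : ContDiff ℝ 1 D :=
    (hic.pow 2).add ((huc.norm_sq ℝ).mul (contDiff_const.sub (contDiff_id.norm_sq ℝ)))
  refine not_exists_contDiff_retraction (r := fun x => x + s x • u x) (fun x hx => ?_)
    (fun x hx => ?_) (fun x hx => ?_)
  · exact contDiffAt_id.add (((hic.contDiffAt.neg.add
      (hDc.contDiffAt.sqrt (hDpos x hx).ne')).div (huc.norm_sq ℝ).contDiffAt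
        (hu0 x hx).ne').smul huc.contDiffAt)
  · have hsq : √(D x) ^ 2 = D x := Real.sq_sqrt (hDpos x hx).le
    have hsu : s x * ‖u x‖ ^ 2 = -inner ℝ x (u x) + √(D x) := div_mul_cancel₀ _ (hu0 x hx).ne'
    have h1 : ‖u x‖ ^ 2 * (‖x + s x • u x‖ ^ 2 - 1) = 0 := by
      rw [norm_add_sq_real, norm_smul, mul_pow, Real.norm_eq_abs, sq_abs, inner_smul_right]
      have h2 : √(D x) = s x * ‖u x‖ ^ 2 + inner ℝ x (u x) := by linarith
      rw [h2] at hsq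
      simp only [hD] at hsq
      linear_combination hsq
    have h2 := (mul_eq_zero.1 h1).resolve_left (hu0 x hx).ne'
    have h3 : ‖x + s x • u x‖ ^ 2 = 1 := by linarith
    exact (pow_eq_one_iff_of_nonneg (norm_nonneg _) two_ne_zero).1 h3
  · have hDx : √(D x) = inner ℝ x (u x) := by
      simp only [hD, hx]
      norm_num
      exact Real.sqrt_sq (hinner x hx).le
    simp [hs, hDx]

/-- **Brouwer's fixed point theorem**, for continuous maps with bounded range. -/
theorem exists_fixedPoint_of_continuous_of_bounded {f : E → E} (hf : Continuous f) {R : ℝ}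
    (hR : ∀ x, ‖f x‖ ≤ R) : ∃ x, f x = x := by
  by_contra! hne
  have hR0 : 0 ≤ R := (norm_nonneg _).trans (hR 0)
  set M := R + 2
  have hM : 0 < M := by positivity
  obtain ⟨x₀, -, hmin⟩ := (isCompact_closedBall (0 : E) M).exists_isMinOn ⟨0, by simp [hM.le]⟩
    (f := fun x => ‖f x - x‖) (hf.sub continuous_id).norm.continuousOn
  set d := ‖f x₀ - x₀‖
  have hd : 0 < d := norm_pos_iff.2 (sub_ne_zero.2 (hne x₀))
  -- A `C¹` approximation closer than `d` has no fixed point in the ball of radius `M`.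
  obtain ⟨g, hgU, hg⟩ : ∃ g : E → E, ContDiff ℝ 1 g ∧
      ∀ x ∈ closedBall (0 : E) M, ‖g x - f x‖ < min d 1 := by
    have hden := ContinuousMap.dense_setOfPred_contDiff (E := E) (F := E)
    have hnhds := (nhds_basis_uniformity (x := (⟨f, hf⟩ : C(E, E)))
      uniformity_basis_dist.compactConvergenceUniformity).mem_of_mem
        (i := (closedBall (0 : E) M, min d 1)) ⟨isCompact_closedBall _ _, by positivity⟩
    obtain ⟨g, hg1, hg2⟩ := hden.inter_nhds_nonempty hnhds
    have hg3 : ContDiff ℝ (⊤ : ℕ∞) g := hg1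
    refine ⟨g, hg3.of_le (by simp), fun x hx => ?_⟩
    rw [← dist_eq_norm]
    exact hg2 x hx
  have hgM : ∀ x ∈ closedBall (0 : E) 1, M • x ∈ closedBall (0 : E) M := by
    intro x hx
    rw [mem_closedBall_zero_iff] at hx ⊢
    rw [norm_smul, Real.norm_of_nonneg hM.le]
    nlinarith
  obtain ⟨x, hx, hfx⟩ := exists_fixedPoint_of_contDiff (f := fun x => M⁻¹ • g (M • x))
    ((hgU.comp (contDiff_const_smul M)).const_smul M⁻¹) (by
      intro x hx
      have h1 := hg _ (hgM x hx)
      have h2 := norm_sub_norm_le (g (M • x)) (f (M • x))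
      have h3 := hR (M • x)
      have h4 := min_le_right d 1
      rw [norm_smul, norm_inv, Real.norm_of_nonneg hM.le, inv_mul_lt_iff₀ hM]
      linarith)
  have hgx : g (M • x) = M • x := by
    conv_rhs => rw [← hfx]
    rw [smul_inv_smul₀ hM.ne']
  have h1 := hg _ (hgM x hx)
  have h2 : d ≤ ‖f (M • x) - M • x‖ := hmin (hgM x hx)
  rw [hgx, norm_sub_rev] at h1
  exact absurd (h1.trans_le (min_le_left _ _)) h2.not_gt

/-- The **Hartman–Stampacchia theorem**. A solution is a fixed point of
`x ↦ P (P x + G (P x))`, where `P` is the metric projection onto `C`. -/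
theorem exists_variational_inequality {C : Set E} (hne : C.Nonempty) (hC : IsCompact C)
    (hconv : Convex ℝ C) {G : E → E} (hG : ContinuousOn G C) :
    ∃ x ∈ C, ∀ y ∈ C, inner ℝ (G x) (y - x) ≤ 0 := by
  have hproj : ∀ u : E, ∃ v ∈ C, ∀ w ∈ C, inner ℝ (u - v) (w - v) ≤ 0 := fun u => by
    obtain ⟨v, hv, h⟩ := exists_norm_eq_iInf_of_complete_convex hne hC.isComplete hconv u
    exact ⟨v, hv, (norm_eq_iInf_iff_real_inner_le_zero hconv hv).1 h⟩
  choose P hPC hP using hproj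
  have hlip : LipschitzWith 1 P := by
    refine LipschitzWith.of_dist_le_mul fun u v => ?_
    rw [dist_eq_norm, dist_eq_norm, NNReal.coe_one, one_mul]
    have h1 := hP u (P v) (hPC v)
    have h2 := hP v (P u) (hPC u)
    have h3 : ‖P u - P v‖ ^ 2 ≤ inner ℝ (u - v) (P u - P v) := by
      have h4 : inner ℝ (u - v) (P u - P v) - ‖P u - P v‖ ^ 2 =
          - inner ℝ (u - P u) (P v - P u) - inner ℝ (v - P v) (P u - P v) := by
        rw [← real_inner_self_eq_norm_sq, ← neg_sub (P u) (P v), inner_neg_right, neg_neg,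
          ← inner_sub_left, ← inner_sub_left]
        congr 1
        abel
      linarith
    have h4 := real_inner_le_norm (u - v) (P u - P v)
    by_contra! hlt
    nlinarith [norm_nonneg (u - v), norm_nonneg (P u - P v)]
  have hid : ∀ x ∈ C, P x = x := by
    intro x hx
    have := hP x x hx
    rw [real_inner_self_eq_norm_sq] at this
    have h0 : ‖x - P x‖ = 0 := by nlinarith [norm_nonneg (x - P x)]
    exact (sub_eq_zero.1 (norm_eq_zero.1 h0)).symm
  obtain ⟨R, hR⟩ := hC.isBounded.exists_norm_le
  have hcont : Continuous fun x => P (P x + G (P x)) :=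
    hlip.continuous.comp (hlip.continuous.add (hG.comp_continuous hlip.continuous hPC))
  obtain ⟨x, hx⟩ := exists_fixedPoint_of_continuous_of_bounded hcont fun x => hR _ (hPC _)
  have hxC : x ∈ C := hx ▸ hPC _
  refine ⟨x, hxC, fun y hy => ?_⟩
  have := hP (P x + G (P x)) y hy
  rwa [hx, hid x hxC, add_sub_cancel_left] at this

end Brouwer

/-! ### The payoff of a user as a function of its own power -/

section SingleUser

/-- The numerator of the derivative of `q ↦ log (1 + a q) / (q + b)` over `(q + b) ^ 2`. Its sign
is the sign of that derivative. -/
noncomputable def marginalNumerator (a b q : ℝ) : ℝ :=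
  a * (q + b) / (1 + a * q) - Real.log (1 + a * q)

/-- With `X = 1 + a p` and `Y = 1 + a q` the claim is
`(ab - 1) (1 / Y - 1 / X) ≤ log Y - log X`, which follows from `log (X / Y) ≤ X / Y - 1`
and `1 ≤ X ≤ Y`. -/
theorem marginalNumerator_anti {a b p q : ℝ} (ha : 0 ≤ a) (hb : 0 ≤ b) (hp : 0 ≤ p)
    (hpq : p ≤ q) : marginalNumerator a b q ≤ marginalNumerator a b p := by
  have hX : 1 ≤ 1 + a * p := by linarith [mul_nonneg ha hp]
  have hXY : 1 + a * p ≤ 1 + a * q := by linarith [mul_le_mul_of_nonneg_left hpq ha]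
  have hrw : ∀ z, 1 ≤ 1 + a * z → a * (z + b) / (1 + a * z) = 1 + (a * b - 1) / (1 + a * z) := by
    intro z hz
    have : 1 + a * z ≠ 0 := by linarith
    field_simp
    ring
  unfold marginalNumerator
  rw [hrw p hX, hrw q (hX.trans hXY)]
  generalize 1 + a * p = X at *
  generalize 1 + a * q = Y at *
  have hX0 : 0 < X := by linarith
  have hY0 : 0 < Y := by linarith
  have hlog := Real.log_le_sub_one_of_pos (div_pos hX0 hY0)
  rw [Real.log_div hX0.ne' hY0.ne'] at hlog
  have h1 : X⁻¹ - Y⁻¹ ≤ 1 - X / Y := by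
    have h : (1 - X / Y) - (X⁻¹ - Y⁻¹) = (X - 1) * (Y - X) / (X * Y) := by field_simp
    have : 0 ≤ (X - 1) * (Y - X) / (X * Y) :=
      div_nonneg (mul_nonneg (by linarith) (by linarith)) (by positivity)
    linarith
  have h2 : a * b * Y⁻¹ ≤ a * b * X⁻¹ :=
    mul_le_mul_of_nonneg_left (inv_anti₀ hX0 hXY) (mul_nonneg ha hb)
  rw [div_eq_mul_inv, div_eq_mul_inv]
  linarith

/-- The payoff of one user as a function of its own power `q`: bandwidth `W`, channel gain divided
by interference plus noise `a`, circuit power `b`, price per unit of transmit power `c`. -/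
noncomputable def netUtility (W a b c q : ℝ) : ℝ := W * Real.log (1 + a * q) / (q + b) - c * q

/-- The derivative of `netUtility`, see `hasDerivAt_netUtility`. -/
noncomputable def marginalUtility (W a b c q : ℝ) : ℝ :=
  W * marginalNumerator a b q / (q + b) ^ 2 - c

theorem hasDerivAt_netUtility {W a b c q : ℝ} (ha : 0 ≤ a) (hb : 0 < b) (hq : 0 ≤ q) :
    HasDerivAt (netUtility W a b c) (marginalUtility W a b c q) q := by
  have h1 : 1 + a * q ≠ 0 := by positivity
  have h2 : q + b ≠ 0 := by positivity
  have hl : HasDerivAt (fun q => Real.log (1 + a * q)) (a / (1 + a * q)) q := by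
    simpa using (((hasDerivAt_id q).const_mul a).const_add 1).log h1
  have := ((hl.const_mul W).div ((hasDerivAt_id q).add_const b) h2).sub
    ((hasDerivAt_id q).const_mul c)
  refine this.congr_deriv ?_
  simp only [marginalUtility, marginalNumerator, id]
  field_simp

/-- The net utility is concave as long as energy efficiency is increasing. -/
theorem marginalUtility_le_of_nonneg_numerator {W a b c p q : ℝ} (hW : 0 ≤ W) (ha : 0 ≤ a)
    (hb : 0 < b) (hp : 0 ≤ p) (hpq : p ≤ q) (hq : 0 ≤ marginalNumerator a b q) :
    marginalUtility W a b c q ≤ marginalUtility W a b c p := by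
  have h1 := marginalNumerator_anti ha hb.le hp hpq
  unfold marginalUtility
  have : 0 ≤ W * marginalNumerator a b p := mul_nonneg hW (hq.trans h1)
  gcongr

/-- Pseudoconcavity of the payoff in the own power: although `netUtility` need not be concave,
first-order optimality on an interval gives global optimality there. -/
theorem netUtility_le_of_stationary {W a b c m p : ℝ} (hW : 0 < W) (ha : 0 ≤ a) (hb : 0 < b)
    (hc : 0 ≤ c) (hp : p ∈ Icc 0 m)
    (hst : ∀ q ∈ Icc 0 m, marginalUtility W a b c p * (q - p) ≤ 0) :
    ∀ q ∈ Icc 0 m, netUtility W a b c q ≤ netUtility W a b c p := by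
  intro q hq
  have hd : ∀ z, 0 ≤ z → HasDerivAt (netUtility W a b c) (marginalUtility W a b c z) z :=
    fun z hz => hasDerivAt_netUtility ha hb hz
  rcases lt_trichotomy q p with hlt | rfl | hlt
  · have h0 : 0 ≤ marginalUtility W a b c p := by
      by_contra! h
      nlinarith [hst q hq]
    -- Since `0 ≤ c`, a nonnegative marginal utility forces a nonnegative numerator.
    have hnum : 0 ≤ marginalNumerator a b p := by
      by_contra! h
      have h1 : W * marginalNumerator a b p / (p + b) ^ 2 < 0 :=
        div_neg_of_neg_of_pos (mul_neg_of_pos_of_neg hW h) (pow_pos (by linarith [hp.1]) 2)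
      unfold marginalUtility at h0
      linarith
    refine monotoneOn_of_hasDerivWithinAt_nonneg (convex_Icc q p)
      (f' := marginalUtility W a b c)
      (fun z hz => (hd z (hq.1.trans hz.1)).continuousAt.continuousWithinAt)
      (fun z hz => (hd z ?_).hasDerivWithinAt) (fun z hz => ?_) (left_mem_Icc.2 hlt.le)
      (right_mem_Icc.2 hlt.le) hlt.le
    all_goals rw [interior_Icc] at hz
    · exact hq.1.trans hz.1.le
    · exact h0.trans (marginalUtility_le_of_nonneg_numerator hW.le ha hb (hq.1.trans hz.1.le)
        hz.2.le hnum)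
  · exact le_rfl
  · have h0 : marginalUtility W a b c p ≤ 0 := by
      by_contra! h
      nlinarith [hst q hq]
    refine antitoneOn_of_hasDerivWithinAt_nonpos (convex_Icc p q)
      (f' := marginalUtility W a b c)
      (fun z hz => (hd z (hp.1.trans hz.1)).continuousAt.continuousWithinAt)
      (fun z hz => (hd z ?_).hasDerivWithinAt) (fun z hz => ?_) (left_mem_Icc.2 hlt.le)
      (right_mem_Icc.2 hlt.le) hlt.le
    all_goals rw [interior_Icc] at hz
    · exact hp.1.trans hz.1.le
    · rcases le_total 0 (marginalNumerator a b z) with h | h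
      · exact (marginalUtility_le_of_nonneg_numerator hW.le ha hb hp.1 hz.1.le h).trans h0
      · have := div_nonpos_of_nonpos_of_nonneg (mul_nonpos_of_nonneg_of_nonpos hW.le h)
          (sq_nonneg (z + b))
        unfold marginalUtility
        linarith

end SingleUser

/-! ### Equilibria of the femtocell game -/

namespace FemtocellNetwork

variable {K : ℕ} (F : FemtocellNetwork K)

/-- Noise plus interference at the `k`-th femtocell receiver: the denominator of `sinr`. -/
noncomputable def interference (p : Fin K → ℝ) (k : Fin K) : ℝ :=
  F.N k.succ + F.h 0 k.succ * F.p₀ + ∑ j ∈ Finset.univ.erase k, F.h j.succ k.succ * p j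

variable {F}

theorem noise_le_interference_and_pos (hF : F.Physical) {p : Fin K → ℝ} (hp : p ∈ F.powerSpace) (k : Fin K) :
    F.N k.succ ≤ F.interference p k ∧ 0 < F.interference p k := by
  have h1 : 0 ≤ ∑ j ∈ Finset.univ.erase k, F.h j.succ k.succ * p j :=
    Finset.sum_nonneg fun j _ => mul_nonneg (hF.h_nonneg _ _) (hp j).1
  have h2 := mul_nonneg (hF.h_nonneg 0 k.succ) hF.p₀_nonneg
  have h3 := hF.N_pos k.succ
  unfold interference
  constructor <;> linarith

theorem userPayoff_update (l p : Fin K → ℝ) (k : Fin K) (q : ℝ) :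
    F.userPayoff l (Function.update p k q) k =
      netUtility F.W (F.h k.succ k.succ / F.interference p k) F.pa (l k * F.h k.succ 0) q := by
  have h : ∑ j ∈ Finset.univ.erase k, F.h j.succ k.succ * Function.update p k q j =
      ∑ j ∈ Finset.univ.erase k, F.h j.succ k.succ * p j :=
    Finset.sum_congr rfl fun j hj => by
      rw [Function.update_of_ne (Finset.ne_of_mem_erase hj)]
  simp only [userPayoff, energyEfficiency, sinr, netUtility, interference, h,
    Function.update_self, div_mul_eq_mul_div]

theorem userPayoff_eq_netUtility (l p : Fin K → ℝ) (k : Fin K) :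
    F.userPayoff l p k =
      netUtility F.W (F.h k.succ k.succ / F.interference p k) F.pa (l k * F.h k.succ 0) (p k) := by
  rw [← userPayoff_update, Function.update_eq_self]

variable (F) in
/-- The pseudogradient of the game between the MBS and the users: each player's payoff is
differentiated in that player's own variables. The coordinates `Sum.inl k` of the joint strategy
are the prices, the coordinates `Sum.inr k` the powers. -/
noncomputable def pseudoGradient (x : EuclideanSpace ℝ (Fin K ⊕ Fin K)) :
    EuclideanSpace ℝ (Fin K ⊕ Fin K) :=
  WithLp.toLp 2 (Sum.elim (fun k => F.h k.succ 0 * x (Sum.inr k)) fun k =>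
    marginalUtility F.W (F.h k.succ k.succ / F.interference (fun j => x (Sum.inr j)) k) F.pa
      (x (Sum.inl k) * F.h k.succ 0) (x (Sum.inr k)))

variable (F) in
/-- The joint strategies with prices in `Λ` and powers in `F.powerSpace`, inside a Euclidean space
so that projections are available. -/
def strategySpace (Λ : Set (Fin K → ℝ)) : Set (EuclideanSpace ℝ (Fin K ⊕ Fin K)) :=
  {x | (fun k => x (Sum.inl k)) ∈ Λ ∧ (fun k => x (Sum.inr k)) ∈ F.powerSpace}

theorem powerSpace_eq_pi : F.powerSpace = Set.univ.pi fun k => Icc 0 (F.pmax k) := by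
  ext p; simp only [powerSpace, Set.mem_ofPred_eq, Set.mem_univ_pi]

theorem isCompact_strategySpace {Λ : Set (Fin K → ℝ)} (hΛ : IsCompact Λ) :
    IsCompact (F.strategySpace Λ) := by
  have hP : IsCompact F.powerSpace := by
    rw [powerSpace_eq_pi]; exact isCompact_univ_pi fun k => isCompact_Icc
  have hc : Continuous fun y : (Fin K → ℝ) × (Fin K → ℝ) =>
      (WithLp.toLp 2 (Sum.elim y.1 y.2) : EuclideanSpace ℝ (Fin K ⊕ Fin K)) := by
    refine (PiLp.continuous_toLp 2 _).comp (continuous_pi fun i => ?_)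
    cases i <;> simp <;> fun_prop
  convert (hΛ.prod hP).image hc using 1
  ext x
  constructor
  · rintro ⟨h1, h2⟩
    refine ⟨(_, _), ⟨h1, h2⟩, ?_⟩
    ext i
    cases i <;> rfl
  · rintro ⟨⟨l, p⟩, ⟨hl, hp⟩, rfl⟩
    exact ⟨hl, hp⟩

theorem convex_strategySpace {Λ : Set (Fin K → ℝ)} (hΛ : Convex ℝ Λ) :
    Convex ℝ (F.strategySpace Λ) := by
  have hP : Convex ℝ F.powerSpace := by
    rw [powerSpace_eq_pi]; exact convex_pi fun k _ => convex_Icc _ _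
  intro x hx y hy a b ha hb hab
  exact ⟨hΛ hx.1 hy.1 ha hb hab, hP hx.2 hy.2 ha hb hab⟩

theorem continuousOn_pseudoGradient (hF : F.Physical) (Λ : Set (Fin K → ℝ)) :
    ContinuousOn F.pseudoGradient (F.strategySpace Λ) := by
  refine (PiLp.continuous_toLp 2 _).comp_continuousOn (continuousOn_pi.2 fun i => ?_)
  rcases i with k | k
  · simp only [Sum.elim_inl]
    fun_prop
  · simp only [Sum.elim_inr, marginalUtility, marginalNumerator]
    have hI : Continuous fun x : EuclideanSpace ℝ (Fin K ⊕ Fin K) =>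
        F.interference (fun j => x (Sum.inr j)) k := by
      unfold interference; fun_prop
    have ha : ContinuousOn (fun x : EuclideanSpace ℝ (Fin K ⊕ Fin K) =>
        F.h k.succ k.succ / F.interference (fun j => x (Sum.inr j)) k) (F.strategySpace Λ) :=
      continuousOn_const.div hI.continuousOn fun x hx => (noise_le_interference_and_pos hF hx.2 k).2.ne'
    have hpos : ∀ x ∈ F.strategySpace Λ, 1 + F.h k.succ k.succ /
        F.interference (fun j => x (Sum.inr j)) k * x (Sum.inr k) ≠ 0 := by
      intro x hx
      have h1 := hF.h_nonneg k.succ k.succ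
      have h2 := (noise_le_interference_and_pos hF hx.2 k).2
      have h3 : 0 ≤ x (Sum.inr k) := (hx.2 k).1
      positivity
    have hpa : ∀ x ∈ F.strategySpace Λ, (x (Sum.inr k) + F.pa) ^ 2 ≠ 0 := by
      intro x hx
      have h3 : 0 ≤ x (Sum.inr k) := (hx.2 k).1
      have := hF.pa_pos
      positivity
    fun_prop (disch := assumption)

theorem exists_isStackelbergEquilibrium (hF : F.Physical) {Λ : Set (Fin K → ℝ)}
    (hne : Λ.Nonempty) (hc : IsCompact Λ) (hconv : Convex ℝ Λ) (hnn : ∀ l ∈ Λ, ∀ k, 0 ≤ l k) :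
    ∃ l p : Fin K → ℝ, F.IsStackelbergEquilibrium Λ l p := by
  obtain ⟨l₀, hl₀⟩ := hne
  have hne' : (F.strategySpace Λ).Nonempty :=
    ⟨WithLp.toLp 2 (Sum.elim l₀ 0), hl₀, fun k => ⟨le_rfl, hF.pmax_nonneg k⟩⟩
  obtain ⟨x, ⟨hxl, hxp⟩, hx⟩ := exists_variational_inequality hne' (isCompact_strategySpace hc)
    (convex_strategySpace hconv) (continuousOn_pseudoGradient hF Λ)
  set l : Fin K → ℝ := fun k => x (Sum.inl k) with hl
  set p : Fin K → ℝ := fun k => x (Sum.inr k) with hp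
  have key : ∀ l' ∈ Λ, ∀ p' ∈ F.powerSpace,
      ∑ k, F.h k.succ 0 * p k * (l' k - l k) +
        ∑ k, marginalUtility F.W (F.h k.succ k.succ / F.interference p k) F.pa
          (l k * F.h k.succ 0) (p k) * (p' k - p k) ≤ 0 := by
    intro l' hl' p' hp'
    have := hx (WithLp.toLp 2 (Sum.elim l' p')) ⟨hl', hp'⟩
    simpa [PiLp.inner_apply, Fintype.sum_sum_type, pseudoGradient, mul_comm, hl, hp] using this
  refine ⟨l, p, ⟨hxl, fun l' hl' => ?_⟩, hxp, fun k q hq => ?_⟩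
  · have := key l' hl' p hxp
    simp only [sub_self, mul_zero, Finset.sum_const_zero, add_zero] at this
    rw [← sub_nonpos, revenue, revenue, ← Finset.sum_sub_distrib]
    refine le_of_eq_of_le (Finset.sum_congr rfl fun k _ => ?_) this
    ring
  · rw [userPayoff_update, userPayoff_eq_netUtility]
    refine netUtility_le_of_stationary hF.W_pos
      (div_nonneg (hF.h_nonneg _ _) (noise_le_interference_and_pos hF hxp k).2.le) hF.pa_pos
      (mul_nonneg (hnn l hxl k) (hF.h_nonneg _ _)) (hxp k) (fun q' hq' => ?_) q hq
    have hupd : Function.update p k q' ∈ F.powerSpace := by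
      intro j
      rcases eq_or_ne j k with rfl | hj
      · simpa using hq'
      · simpa [hj] using hxp j
    -- Only the `k`-th summand survives when `k` alone deviates.
    have := key l hxl _ hupd
    simp only [sub_self, mul_zero, Finset.sum_const_zero, zero_add] at this
    rw [Finset.sum_eq_single k (fun j _ hj => by simp [hj]) (by simp)] at this
    simpa using this

/-- Impose prices `l` so high that every user with a nonzero gain to the MBS stays silent. The
revenue is then zero whatever the prices, so that `l` is optimal for the MBS. -/
theorem exists_isStackelbergEquilibrium_nonneg (hF : F.Physical) :
    ∃ l p : Fin K → ℝ, F.IsStackelbergEquilibrium {l | ∀ k, 0 ≤ l k} l p := by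
  -- `W * h / (N * pa)` bounds the slope of energy efficiency. If `F.h k.succ 0 = 0`, then
  -- `l k = 0` by division by zero; the price of such a user is irrelevant.
  set l : Fin K → ℝ := fun k =>
    (F.W * F.h k.succ k.succ / (F.N k.succ * F.pa) + 1) / F.h k.succ 0 with hl
  have hl0 : ∀ k, 0 ≤ l k := fun k => by
    have := hF.W_pos; have := hF.N_pos k.succ; have := hF.pa_pos
    have := hF.h_nonneg k.succ k.succ; have := hF.h_nonneg k.succ 0
    positivity
  obtain ⟨_, p, ⟨rfl, -⟩, hp, hbr⟩ := exists_isStackelbergEquilibrium hF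
    (singleton_nonempty l) isCompact_singleton (convex_singleton l) (by simpa using hl0)
  have hzero : ∀ k, F.h k.succ 0 * p k = 0 := by
    intro k
    by_contra hne
    obtain ⟨hh, hpk⟩ := mul_ne_zero_iff.1 hne
    have hpk0 : 0 < p k := lt_of_le_of_ne (hp k).1 hpk.symm
    have h0 := hbr k 0 ⟨le_rfl, hF.pmax_nonneg k⟩
    rw [userPayoff_update, userPayoff_eq_netUtility] at h0
    have hprice : l k * F.h k.succ 0 = F.W * F.h k.succ k.succ / (F.N k.succ * F.pa) + 1 :=
      div_mul_cancel₀ _ hh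
    rw [hprice] at h0
    obtain ⟨hI1, hI2⟩ := noise_le_interference_and_pos hF hp k
    have hW := hF.W_pos
    have hN := hF.N_pos k.succ
    have hpa := hF.pa_pos
    have hkk := hF.h_nonneg k.succ k.succ
    set a := F.h k.succ k.succ / F.interference p k with ha
    have ha0 : 0 ≤ a := by positivity
    have hlog : Real.log (1 + a * p k) ≤ F.h k.succ k.succ / F.N k.succ * p k := by
      have h1 := Real.log_le_sub_one_of_pos (show 0 < 1 + a * p k by positivity)
      have h2 : a * p k ≤ F.h k.succ k.succ / F.N k.succ * p k := by rw [ha]; gcongr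
      linarith
    have hEE : F.W * Real.log (1 + a * p k) / (p k + F.pa) ≤
        F.W * F.h k.succ k.succ / (F.N k.succ * F.pa) * p k := by
      calc _ ≤ F.W * (F.h k.succ k.succ / F.N k.succ * p k) / (0 + F.pa) := by gcongr
        _ = _ := by field_simp; simp
    simp only [netUtility, mul_zero, add_zero, Real.log_one, zero_div, sub_self] at h0
    linarith
  have hrev : ∀ l' : Fin K → ℝ, F.revenue l' p = 0 := fun l' =>
    Finset.sum_eq_zero fun k _ => by rw [mul_assoc, hzero, mul_zero]
  exact ⟨l, p, ⟨hl0, fun l' _ => by rw [hrev, hrev]⟩, hp, hbr⟩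

end FemtocellNetwork

theorem theorem3 {K : ℕ} (F : FemtocellNetwork K) (hF : F.Physical) :
    (∃ l p : Fin K → ℝ, F.IsStackelbergEquilibrium {l | ∀ k, 0 ≤ l k} l p) ∧
    (∀ Λ : Set (Fin K → ℝ), Λ.Nonempty → IsCompact Λ → Convex ℝ Λ →
      (∀ l ∈ Λ, ∀ k, 0 ≤ l k) →
      ∃ l p : Fin K → ℝ, F.IsStackelbergEquilibrium Λ l p) :=
  ⟨FemtocellNetwork.exists_isStackelbergEquilibrium_nonneg hF,
    fun _ hne hc hconv hnn => FemtocellNetwork.exists_isStackelbergEquilibrium hF hne hc hconv hnn⟩
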